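/- Let $A$ be a finite set, let $B$ be a set, let $n \geq 2$, and let $f \colon A^n \to B$ depend on all of its variables. Here $f$ \emph{depends} on $x_i$ (the variable $x_i$ is \emph{essential} in $f$) if changing only the $i$-th entry of some tuple changes the value of $f$, and the \emph{essential arity} $\operatorname{ess} f$ is the number of essential variables. For $g \colon A^m \to B$ write $g \leq f$ if there is $\sigma \colon \{1,\dots,n\} \to \{1,\dots,m\}$ with $g(a_1,\dots,a_m) = f(a_{\sigma(1)},\dots,a_{\sigma(n)})$ for all $a \in A^m$, and $g < f$ if $g \leq f$ and $f \not\leq g$. The \emph{arity gap} of $f$ is $\operatorname{gap} f = \operatorname{ess} f - \max_{g<f} \operatorname{ess} g$, where $g$ ranges over the $B$-valued functions on $A$ of all positive arities. Let $A^n_{=} = \{(a_1,\dots,a_n) \in A^n : a_i = a_j \text{ for some } i \neq j\}$. The \emph{quasi-arity} $\operatorname{qa} f$ is the minimum of $\operatorname{ess} g$ over all $g \colon A^n \to B$ with $g|_{A^n_{=}} = f|_{A^n_{=}}$. For $\mathbf{a} \in A^n$ let $\operatorname{oddsupp}(\mathbf{a})$ be the set of those elements of $A$ that occur an odd number of times among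 $a_1,\dots,a_n$, and let $\mathcal{P}'(A)$ be the set of all subsets of $A$ that have at most $n-2$ elements and whose number of elements has the same parity as $n$; then $\operatorname{oddsupp}(\mathbf{a}) \in \mathcal{P}'(A)$ for $\mathbf{a} \in A^n_{=}$. We say that $f|_{A^n_{=}}$ is \emph{determined by $\operatorname{oddsupp}$} if there is a nonconstant $f^* \colon \mathcal{P}'(A) \to B$ with $f(\mathbf{a}) = f^*(\operatorname{oddsupp}(\mathbf{a}))$ for all $\mathbf{a} \in A^n_{=}$. Then the following hold. (i) For every integer $m$ with $0 \leq m \leq n-3$: $\operatorname{gap} f = n-m$ if and only if $\operatorname{qa} f = m$. (ii) If $n \neq 3$: $\operatorname{gap} f = 2$ if and only if either $\operatorname{qa} f = n-2$, or $\operatorname{qa} f = n$ and $f|_{A^n_{=}}$ is determined by $\operatorname{oddsupp}$. (iii) If $n = 3$: $\operatorname{gap} f = 2$ if and only if there are a nonconstant function $h \colon A \to B$ and $i_1, i_2, i_3 \in \{0,1\}$ such that, for all $x_0, x_1 \in A$, \[ f(x_1,x_0,x_0) = h(x_{i_1}), \quad f(x_0,x_1,x_0) = h(x_{i_2}), \quad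 f(x_0,x_0,x_1) = h(x_{i_3}). \] (iv) Otherwise, $\operatorname{gap} f = 1$; that is, $\operatorname{gap} f = 1$ whenever $\operatorname{qa} f > n-3$, the condition on the right-hand side of (ii) fails if $n \neq 3$, and the condition on the right-hand side of (iii) fails if $n = 3$. -/

import Mathlib

/-! Functions of several variables `f : (Fin n → A) → B`: essential variables, simple minors,
arity gap, supports and quasi-arity, and `oddsupp`. -/

namespace ArityGap

variable {A B : Type*}

/-- The `i`-th variable is essential in `f`: changing only the `i`-th entry of some tuple
changes the value of `f`. -/
def IsEssential {n : ℕ} (f : (Fin n → A) → B) (i : Fin n) : Prop :=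
  ∃ (a : Fin n → A) (b : A), f a ≠ f (Function.update a i b)

/-- `f` depends on all of its variables. -/
def DependsOnAll {n : ℕ} (f : (Fin n → A) → B) : Prop :=
  ∀ i, IsEssential f i

/-- The essential arity: the number of essential variables. -/
noncomputable def ess {n : ℕ} (f : (Fin n → A) → B) : ℕ :=
  {i | IsEssential f i}.ncard

/-- `g ≤ f`: `g` is obtained from `f` by simple variable substitution, that is,
`g = f (x_{σ 1}, …, x_{σ n})`. -/
def IsSimpleMinor {m n : ℕ} (g : (Fin m → A) → B) (f : (Fin n → A) → B) : Prop :=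
  ∃ σ : Fin n → Fin m, ∀ a, g a = f (fun i => a (σ i))

/-- `g < f` in the simple minor quasi-order. -/
def IsStrictMinor {m n : ℕ} (g : (Fin m → A) → B) (f : (Fin n → A) → B) : Prop :=
  IsSimpleMinor g f ∧ ¬ IsSimpleMinor f g

/-- The essential arities of the functions `g < f` (of any positive arity). -/
def strictMinorArities {n : ℕ} (f : (Fin n → A) → B) : Set ℕ :=
  {r | ∃ (m : ℕ) (g : (Fin m → A) → B), 0 < m ∧ IsStrictMinor g f ∧ ess g = r}

/-- The maximum of the essential arities of the functions `g < f`. -/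
noncomputable def essLower {n : ℕ} (f : (Fin n → A) → B) : ℕ :=
  sSup (strictMinorArities f)

/-- The arity gap of `f`. -/
noncomputable def gap {n : ℕ} (f : (Fin n → A) → B) : ℕ :=
  ess f - essLower f

/-- For `n ≥ 2`, the set of all `n`-tuples with a repeated entry. -/
def eqTuples (A : Type*) (n : ℕ) : Set (Fin n → A) :=
  {a | ∃ i j, i ≠ j ∧ a i = a j}

/-- `g` is a support of `f`: they agree on the tuples with a repeated entry. -/
def IsSupport {n : ℕ} (g f : (Fin n → A) → B) : Prop :=
  ∀ a ∈ eqTuples A n, g a = f a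

/-- The quasi-arity: the minimum of the essential arities of the supports of `f`. -/
noncomputable def qa {n : ℕ} (f : (Fin n → A) → B) : ℕ :=
  sInf {r | ∃ g : (Fin n → A) → B, IsSupport g f ∧ ess g = r}

/-- The set of the entries that occur an odd number of times in `a`. -/
def oddsupp {n : ℕ} (a : Fin n → A) : Set A :=
  {x | ∃ i, a i = x ∧ Odd {j | a j = a i}.ncard}

/-- The (finite) subsets of `A` of size at most `n - 2` whose size has the parity of `n`. -/
def paritySubsets (A : Type*) (n : ℕ) : Set (Set A) :=
  {S | S.Finite ∧ S.ncard + 2 ≤ n ∧ (Even S.ncard ↔ Even n)}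

theorem oddsupp_mem {n : ℕ} {a : Fin n → A} (ha : a ∈ eqTuples A n) :
    oddsupp a ∈ paritySubsets A n := by
  classical
  have key : oddsupp a =
      (((Finset.univ.image a).filter
        fun x => Odd (Finset.univ.filter fun j => a j = x).card : Finset A) : Set A) := by
    ext x
    simp only [oddsupp, Set.mem_ofPred_eq, Finset.coe_filter, Finset.mem_image, Finset.mem_univ,
      true_and]
    have hc : ∀ y : A, {j | a j = y}.ncard = (Finset.univ.filter fun j => a j = y).card := by
      intro y
      rw [← Set.ncard_coe_finset]
      simp
    constructor
    · rintro ⟨i, rfl, h⟩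
      exact ⟨⟨i, rfl⟩, by rwa [hc] at h⟩
    · rintro ⟨⟨i, rfl⟩, h⟩
      exact ⟨i, rfl, by rwa [hc]⟩
  have hsum : n = ∑ x ∈ Finset.univ.image a, (Finset.univ.filter fun j => a j = x).card := by
    have h := Finset.card_eq_sum_card_image a (Finset.univ : Finset (Fin n))
    simpa using h
  have hpar : Odd n ↔ Odd (oddsupp a).ncard := by
    rw [key, Set.ncard_coe_finset]
    conv_lhs => rw [hsum]
    exact Finset.odd_sum_iff_odd_card_odd _
  have hlt : (Finset.univ.image a).card < n := by
    obtain ⟨i, j, hij, h⟩ := ha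
    refine lt_of_le_of_ne (by simpa using Finset.card_image_le (s := Finset.univ) (f := a)) ?_
    intro hcard
    have hinj : Set.InjOn a (Finset.univ : Finset (Fin n)) :=
      Finset.card_image_iff.1 (by simpa using hcard)
    exact hij (hinj (by simp) (by simp) h)
  have hle : (oddsupp a).ncard ≤ (Finset.univ.image a).card := by
    rw [key, Set.ncard_coe_finset]
    exact Finset.card_filter_le _ _
  refine ⟨by rw [key]; exact Finset.finite_toSet _, ?_, ?_⟩
  · rw [Nat.odd_iff, Nat.odd_iff] at hpar
    omega
  · rw [← Nat.not_odd_iff_even, ← Nat.not_odd_iff_even, hpar]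

/-- The restriction of `f` to the tuples with a repeated entry is determined by `oddsupp`:
it is `φ ∘ oddsupp` with a nonconstant `φ`. -/
def IsDeterminedByOddsupp {n : ℕ} (f : (Fin n → A) → B) : Prop :=
  ∃ φ : paritySubsets A n → B, (∃ S T, φ S ≠ φ T) ∧
    ∀ (a : Fin n → A) (ha : a ∈ eqTuples A n), f a = φ ⟨oddsupp a, oddsupp_mem ha⟩

/-- For a ternary `f`: there are a nonconstant unary `h` and `i₁, i₂, i₃ ∈ {0, 1}` with
`f (x₁, x₀, x₀) = h (x_{i₁})`, `f (x₀, x₁, x₀) = h (x_{i₂})`, `f (x₀, x₀, x₁) = h (x_{i₃})`. -/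
def HasUnaryIdentifications {n : ℕ} (f : (Fin n → A) → B) (hn : n = 3) : Prop :=
  ∃ (h : A → B) (i₁ i₂ i₃ : Fin 2), (∃ s t, h s ≠ h t) ∧
    ∀ x : Fin 2 → A,
      f (fun i => ![x 1, x 0, x 0] (Fin.cast hn i)) = h (x i₁) ∧
      f (fun i => ![x 0, x 1, x 0] (Fin.cast hn i)) = h (x i₂) ∧
      f (fun i => ![x 0, x 0, x 1] (Fin.cast hn i)) = h (x i₃)

/-! The maximum and the minimum above are attained, and `gap` involves no truncation. -/

theorem apply_eq_of_eqOn_essential {n : ℕ} (f : (Fin n → A) → B) (s : Finset (Fin n)) :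
    ∀ a b : Fin n → A, (∀ i ∈ s, ¬ IsEssential f i) → (∀ i ∉ s, a i = b i) → f a = f b := by
  classical
  induction s using Finset.induction_on with
  | empty =>
    intro a b _ h
    exact congrArg f (funext fun i => h i (by simp))
  | insert k s hk ih =>
    intro a b hs h
    have h1 : f a = f (Function.update a k (b k)) := by
      by_contra hne
      exact hs k (by simp) ⟨a, b k, hne⟩
    rw [h1]
    refine ih _ _ (fun i hi => hs i (by simp [hi])) fun i hi => ?_
    by_cases hik : i = k
    · subst hik
      simp
    · rw [Function.update_of_ne hik]
      exact h i (by simp [hik, hi])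

theorem ess_le_of_isSimpleMinor {m n : ℕ} {g : (Fin m → A) → B} {f : (Fin n → A) → B}
    (h : IsSimpleMinor g f) : ess g ≤ ess f := by
  classical
  obtain ⟨σ, hσ⟩ := h
  have hsub : {i | IsEssential g i} ⊆ σ '' {i | IsEssential f i} := by
    rintro i ⟨a, b, hab⟩
    by_contra hi
    refine hab ?_
    rw [hσ, hσ]
    refine apply_eq_of_eqOn_essential f (Finset.univ.filter fun j => σ j = i) _ _ ?_ ?_
    · intro j hj hess
      exact hi ⟨j, hess, by simpa using hj⟩
    · intro j hj
      have hj' : σ j ≠ i := by simpa using hj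
      simp [Function.update_of_ne hj']
  exact (Set.ncard_le_ncard hsub (Set.toFinite _)).trans (Set.ncard_image_le (Set.toFinite _))

theorem isGreatest_essLower {n : ℕ} {f : (Fin n → A) → B} (hf : 2 ≤ ess f) :
    IsGreatest (strictMinorArities f) (essLower f) := by
  have hb : BddAbove (strictMinorArities f) :=
    ⟨ess f, by rintro r ⟨m, g, -, hg, rfl⟩; exact ess_le_of_isSimpleMinor hg.1⟩
  have hne : (strictMinorArities f).Nonempty := by
    refine ⟨_, 1, fun a => f (fun _ => a 0), one_pos, ⟨⟨fun _ => 0, fun _ => rfl⟩, ?_⟩, rfl⟩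
    intro h
    have h1 := ess_le_of_isSimpleMinor h
    have h2 : ess (fun a : Fin 1 → A => f (fun _ => a 0)) ≤ 1 := by
      refine (Set.ncard_le_ncard (Set.subset_univ _) (Set.toFinite _)).trans ?_
      simp
    omega
  exact ⟨Nat.sSup_mem hne hb, fun r hr => le_csSup hb hr⟩

theorem essLower_le_ess {n : ℕ} {f : (Fin n → A) → B} (hf : 2 ≤ ess f) :
    essLower f ≤ ess f := by
  obtain ⟨m, g, -, hg, h⟩ := (isGreatest_essLower hf).1
  exact h ▸ ess_le_of_isSimpleMinor hg.1

theorem isLeast_qa {n : ℕ} (f : (Fin n → A) → B) :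
    IsLeast {r | ∃ g : (Fin n → A) → B, IsSupport g f ∧ ess g = r} (qa f) :=
  ⟨Nat.sInf_mem ⟨_, f, fun _ _ => rfl, rfl⟩, fun _ hr => Nat.sInf_le hr⟩

end ArityGap

namespace ArityGap

open Function

variable {A B : Type*}

/-! A strict minor of `f` must identify two variables, so the maximum in the gap is attained by some
`ident f i j` and gap f = n - `essLower f`. These minors only see `f` on tuples with a repeated
entry, so `f` may be replaced by any support `g`. If qa f < n, a support `g` of least essential
arity misses a variable i, and identifying i with any j returns `g` itself; hence `essLower f` = qa
f. This settles everything except qa f = n.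

Let qa f = n, n ≥ 4, and suppose that every identification minor misses at least two variables
(otherwise the gap is 1). The claim is that the identified variable is inessential in every `ident f
i j`. The engine is `not_isEssential_of_merge`: merging two essential variables lowers the essential
arity, so a minor whose further identification is still of maximal arity has an inessential variable
among the merged ones. Applied to a maximal minor G = `ident f i j` with i, j both inessential
(`exists_ident_not_isEssential`), it leaves two options for each third variable (`ident_dichotomy`).
Either one option holds throughout and G is a support, against qa f = n, or the other one spreads to
all pairs and gives the claim.

By the claim, two equal entries may be changed together without affecting `f`. Such moves realise
all permutations and collect all repetitions in one element, so only the parities of the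
multiplicities matter: `f` is determined by `oddsupp`, and by symmetry the gap is then exactly 2.
For n = 3 there is no fourth variable to argue with, and the minors of arity at most 1 are computed
directly. -/

/-- The identification minor of `f` in which the `i`-th variable is replaced by the `j`-th. -/
def ident {n : ℕ} (f : (Fin n → A) → B) (i j : Fin n) : (Fin n → A) → B :=
  fun a => f (update a i (a j))

/-! ### Essential variables and identification minors -/

section Basic

variable {n : ℕ} {f g P : (Fin n → A) → B} {i j k p q : Fin n}

theorem not_isEssential_iff : ¬ IsEssential f i ↔ ∀ a c, f (update a i c) = f a := by
  simp only [IsEssential, not_exists, not_not]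
  exact ⟨fun h a c => (h a c).symm, fun h a c => (h a c).symm⟩

theorem exists_notMem_of_card_lt (s : Finset (Fin n)) (h : s.card < n) : ∃ k, k ∉ s := by
  by_contra! hs
  have : s = Finset.univ := Finset.eq_univ_of_forall hs
  subst this
  simp at h

theorem ess_add_card_le (s : Finset (Fin n)) (h : ∀ i ∈ s, ¬ IsEssential f i) :
    ess f + s.card ≤ n := by
  classical
  have h1 : {i | IsEssential f i} ⊆ ((sᶜ : Finset (Fin n)) : Set (Fin n)) := by
    intro i hi
    simp only [Finset.coe_compl, Set.mem_compl_iff, Finset.mem_coe]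
    exact fun his => h i his hi
  have h2 := Set.ncard_le_ncard h1 (Set.toFinite _)
  rw [Set.ncard_coe_finset, Finset.card_compl, Fintype.card_fin] at h2
  have h3 : s.card ≤ n := by simpa using s.card_le_univ
  have h4 : ess f ≤ n - s.card := h2
  omega

theorem le_ess_of_isEssential (s : Finset (Fin n)) (h : ∀ i ∈ s, IsEssential f i) :
    s.card ≤ ess f := by
  rw [← Set.ncard_coe_finset]
  exact Set.ncard_le_ncard (fun i hi => h i hi) (Set.toFinite _)

theorem exists_not_isEssential (s : Finset (Fin n)) (h : ess f + s.card < n) :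
    ∃ k ∉ s, ¬ IsEssential f k := by
  classical
  by_contra! hs
  have := le_ess_of_isEssential (f := f) sᶜ fun i hi => hs i (by simpa using hi)
  rw [Finset.card_compl, Fintype.card_fin] at this
  omega

theorem ess_eq_zero_iff : ess f = 0 ↔ ∀ a b, f a = f b := by
  constructor
  · intro h a b
    refine apply_eq_of_eqOn_essential f Finset.univ a b (fun i _ hi => ?_) (by simp)
    have := le_ess_of_isEssential (f := f) {i} (by simpa using hi)
    simp [h] at this
  · intro h
    have := ess_add_card_le (f := f) Finset.univ fun i _ ⟨a, b, hab⟩ => hab (h _ _)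
    simpa using this

theorem ess_of_dependsOnAll (hf : DependsOnAll f) : ess f = n := by
  refine le_antisymm (by simpa using ess_add_card_le (f := f) ∅ (by simp)) ?_
  simpa using le_ess_of_isEssential (f := f) Finset.univ fun i _ => hf i

theorem ident_apply_of_eq {a : Fin n → A} (h : a i = a j) : ident f i j a = f a := by
  rw [ident, ← h, update_eq_self]

theorem not_isEssential_ident_left (hij : i ≠ j) : ¬ IsEssential (ident f i j) i := by
  rw [not_isEssential_iff]
  intro a c
  simp [ident, update_of_ne hij.symm]

theorem ident_isSimpleMinor : IsSimpleMinor (ident f i j) f :=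
  ⟨update id i j, fun a => by
    refine congrArg f (funext fun k => ?_)
    by_cases h : k = i <;> simp [h]⟩

theorem update_mem_eqTuples (hij : i ≠ j) (a : Fin n → A) : update a i (a j) ∈ eqTuples A n :=
  ⟨i, j, hij, by simp [update_of_ne hij.symm]⟩

theorem ident_eq_of_isSupport (h : IsSupport g f) (hij : i ≠ j) : ident f i j = ident g i j :=
  funext fun a => (h _ (update_mem_eqTuples hij a)).symm

/-- If a function `P` that arises from `g` by replacing the variable `p` by the variable `q` has
at least the essential arity of `g`, then `p` and `q` are not both essential in `g`. -/
theorem not_isEssential_of_merge (hpq : p ≠ q) (hP : ∀ a, g (update a p (a q)) = P a)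
    (h : ess g ≤ ess P) : ¬ IsEssential g p ∨ ¬ IsEssential g q := by
  by_contra! hpq'
  obtain ⟨hp, hq⟩ := hpq'
  -- Merging p into q destroys p, and the only variable that could gain dependence is q, which was
  -- essential already.
  have hsub : {i | IsEssential P i} ⊂ {i | IsEssential g i} := by
    have hPp : ¬ IsEssential P p := by
      rw [not_isEssential_iff]
      intro a c
      simp [← hP, update_of_ne hpq.symm]
    refine ⟨fun k hk => ?_, fun hsub => hPp (hsub hp)⟩
    by_contra hgk
    have hgk' : ¬ IsEssential g k := hgk
    have hkp : k ≠ p := fun h => hPp (h ▸ hk)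
    have hkq : k ≠ q := fun h => hgk' (h ▸ hq)
    refine not_isEssential_iff.2 (fun a c => ?_) hk
    rw [← hP, ← hP, update_of_ne hkq.symm, update_comm hkp, not_isEssential_iff.1 hgk']
  exact absurd (Set.ncard_lt_ncard hsub (Set.toFinite _)) (by simpa [ess] using h)

end Basic

/-! ### Maximal strict minors and the quasi-arity -/

section Lower

variable {n : ℕ} {f g : (Fin n → A) → B}

theorem ess_ident_le_essLower (hn : 2 ≤ n) (hf : DependsOnAll f) {i j : Fin n} (hij : i ≠ j) :
    ess (ident f i j) ≤ essLower f := by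
  have he := ess_of_dependsOnAll hf
  refine (isGreatest_essLower (by omega)).2 ⟨n, _, by omega, ⟨ident_isSimpleMinor, fun h => ?_⟩, rfl⟩
  have h1 := ess_le_of_isSimpleMinor h
  have h2 := ess_add_card_le {i} fun k hk => by
    rw [Finset.mem_singleton.1 hk]
    exact not_isEssential_ident_left (f := f) hij
  simp at h2
  omega

theorem exists_ess_ident_eq_essLower (hn : 2 ≤ n) (hf : DependsOnAll f) :
    ∃ i j, i ≠ j ∧ ess (ident f i j) = essLower f := by
  have he := ess_of_dependsOnAll hf
  obtain ⟨m, g, hm, ⟨⟨σ, hσ⟩, hfg⟩, h⟩ := (isGreatest_essLower (f := f) (by omega)).1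
  -- A left inverse of an injective σ would exhibit `f` as a minor of `g`.
  have hinj : ¬ Injective σ := by
    intro hσi
    have : Nonempty (Fin n) := ⟨⟨0, by omega⟩⟩
    refine hfg ⟨invFun σ, fun a => ?_⟩
    rw [hσ]
    exact congrArg f (funext fun i => by rw [leftInverse_invFun hσi i])
  simp only [Injective, not_forall] at hinj
  obtain ⟨i, j, hij, hne⟩ := hinj
  refine ⟨i, j, hne, le_antisymm (ess_ident_le_essLower hn hf hne) ?_⟩
  rw [← h]
  refine ess_le_of_isSimpleMinor ⟨σ, fun a => ?_⟩
  rw [ident_apply_of_eq (by rw [hij]), hσ]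

theorem essLower_le_pred (hn : 2 ≤ n) (hf : DependsOnAll f) : essLower f + 1 ≤ n := by
  obtain ⟨i, j, hij, h⟩ := exists_ess_ident_eq_essLower hn hf
  have h2 := ess_add_card_le {i} fun k hk => by
    rw [Finset.mem_singleton.1 hk]
    exact not_isEssential_ident_left (f := f) hij
  simpa [h] using h2

theorem gap_eq (hf : DependsOnAll f) : gap f = n - essLower f := by
  rw [gap, ess_of_dependsOnAll hf]

theorem qa_le : qa f ≤ n := by
  have := (isLeast_qa f).2 ⟨f, fun _ _ => rfl, rfl⟩
  exact this.trans (by simpa using ess_add_card_le (f := f) ∅ (by simp))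

/-- A support with an inessential variable is itself an identification minor of `f`, and all other
identification minors of `f` are minors of it. -/
theorem essLower_eq_qa (hn : 2 ≤ n) (hf : DependsOnAll f) (h : qa f < n) :
    essLower f = qa f := by
  obtain ⟨g, hg, hgq⟩ := (isLeast_qa f).1
  apply le_antisymm
  · obtain ⟨i, j, hij, he⟩ := exists_ess_ident_eq_essLower hn hf
    rw [← he, ident_eq_of_isSupport hg hij, ← hgq]
    exact ess_le_of_isSimpleMinor ident_isSimpleMinor
  · obtain ⟨i, -, hi⟩ := exists_not_isEssential (f := g) ∅ (by simpa [hgq] using h)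
    obtain ⟨j, hj⟩ := exists_notMem_of_card_lt {i} (by simpa using (by omega : 1 < n))
    have hij : i ≠ j := fun h => hj (by simp [h])
    have : ident f i j = g := by
      rw [ident_eq_of_isSupport hg hij]
      exact funext fun a => not_isEssential_iff.1 hi _ _
    rw [← hgq, ← this]
    exact ess_ident_le_essLower hn hf hij

/-- Constant identification minors all take the diagonal value f(c, …, c), so one constant function
supports `f`. -/
theorem qa_eq_zero (hn : 2 ≤ n) (hf : DependsOnAll f)
    (h : ∀ i j, i ≠ j → ess (ident f i j) = 0) : qa f = 0 := by
  obtain ⟨-, c, -⟩ := hf ⟨0, by omega⟩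
  refine Nat.le_zero.1 ((isLeast_qa f).2 ⟨fun _ => f fun _ => c, ?_, ?_⟩)
  · rintro a ⟨i, j, hij, ha⟩
    have h1 := ess_eq_zero_iff.1 (h i j hij) a fun _ => c
    rw [ident_apply_of_eq ha, ident_apply_of_eq (a := fun _ => c) rfl] at h1
    exact h1.symm
  · exact ess_eq_zero_iff.2 fun _ _ => rfl

theorem qa_eq_zero_of_essLower (hn : 2 ≤ n) (hf : DependsOnAll f) (h : essLower f = 0) :
    qa f = 0 :=
  qa_eq_zero hn hf fun _ _ hij => Nat.le_zero.1 (h ▸ ess_ident_le_essLower hn hf hij)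

end Lower

/-! ### A maximal identification minor without the identified variable -/

section Maximal

variable {n : ℕ} {f : (Fin n → A) → B}

/-- If `M a x` does not depend on the `j`-th entry of `a`, then substituting the `k`-th entry for
`x` gives at most the essential arity that substituting the `j`-th entry gives. -/
theorem ess_le_of_rename {M : (Fin n → A) → A → B} {j k : Fin n}
    (hM : ∀ a x c, M (update a j c) x = M a x) :
    ess (fun a => M a (a k)) ≤ ess (fun a => M a (a j)) :=
  ess_le_of_isSimpleMinor ⟨update id j k, fun a => by
    have h : (fun i => a (update id j k i)) = update a j (a k) := by
      funext i
      by_cases hi : i = j <;> simp [hi]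
    simp only [h, hM, update_self]⟩

/-- Among the identification minors of maximal essential arity there is one in which the
identified variable is inessential. -/
theorem exists_ident_not_isEssential (hn : 4 ≤ n) {m : ℕ} (hm : m + 2 ≤ n)
    (hmax : ∀ i j, i ≠ j → ess (ident f i j) ≤ m) {i j : Fin n} (hij : i ≠ j)
    (he : ess (ident f i j) = m) :
    ∃ i j, i ≠ j ∧ ess (ident f i j) = m ∧ ¬ IsEssential (ident f i j) j := by
  by_cases hj : IsEssential (ident f i j) j
  swap
  · exact ⟨i, j, hij, he, hj⟩
  obtain ⟨k, hki, hk⟩ := exists_not_isEssential (f := ident f i j) {i} (by simp; omega)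
  have hki : k ≠ i := by simpa using hki
  have hkj : k ≠ j := fun h => hk (h ▸ hj)
  obtain ⟨l, hl⟩ := exists_notMem_of_card_lt {i, j, k} (Finset.card_le_three.trans_lt hn)
  simp only [Finset.mem_insert, Finset.mem_singleton, not_or] at hl
  obtain ⟨hli, hlj, hlk⟩ := hl
  have hk' := not_isEssential_iff.1 hk
  -- Here i, j, k are all replaced by x. Since k is inessential in `ident f i j`, that minor is M
  -- with x = a j, and k can take over the role of j.
  set M : (Fin n → A) → A → B :=
    fun a x => f (update (update (update a i x) j x) k x) with hMdef
  have hMi : ∀ a x c, M (update a i c) x = M a x := fun a x c => by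
    simp only [hMdef]; congr 1; clear * - hij hki hkj; grind [update_apply]
  have hMj : ∀ a x c, M (update a j c) x = M a x := fun a x c => by
    simp only [hMdef]; congr 1; clear * - hij hki hkj; grind [update_apply]
  have hMk : ∀ a x c, M (update a k c) x = M a x := fun a x c => by
    simp only [hMdef]; congr 1; clear * - hij hki hkj; grind [update_apply]
  have hij' : ∀ a, a i = a j → f a = M a (a j) := fun a ha => by
    rw [← ident_apply_of_eq (f := f) ha, ← hk' a (a j)]
    simp only [hMdef, ident]; congr 1; clear * - hij hki hkj; grind [update_apply]
  have hPM : ident f i j = fun a => M a (a j) := funext fun a => by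
    rw [ident, hij' _ (by simp [update_of_ne hij.symm]), hMi, update_of_ne hij.symm]
  by_contra! h1
  have hess : ess (fun a => M a (a k)) = m :=
    le_antisymm ((ess_le_of_rename hMj).trans (by rw [← hPM, he]))
      (he.symm.le.trans (by rw [hPM]; exact ess_le_of_rename hMk))
  -- The minor `ident f p k` is again of maximal arity, so k is essential in it by the contradiction
  -- hypothesis `h1`; the inessential variable must be q.
  have key : ∀ p q, p ≠ k → q ≠ k → (∀ a, ident f p k (update a q (a k)) = M a (a k)) →
      ∀ a, a p = a k → f a = M a (a k) := by
    intro p q hp hq hmerge a ha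
    have hle : ess (ident f p k) ≤ ess (fun a => M a (a k)) := hess ▸ hmax p k hp
    have hge : ess (fun a => M a (a k)) ≤ ess (ident f p k) :=
      ess_le_of_isSimpleMinor ⟨update id q k, fun a => by
        refine (hmerge a).symm.trans (congrArg _ (funext fun t => ?_))
        by_cases ht : t = q <;> simp [ht]⟩
    rcases not_isEssential_of_merge hq hmerge hle with h | h
    · rw [← hmerge, not_isEssential_iff.1 h, ident_apply_of_eq ha]
    · exact absurd (h1 p k hp (le_antisymm (hess ▸ hle) (hess ▸ hge))) (by simpa using h)
  have hik' : ∀ a, a i = a k → f a = M a (a k) := key i j hki.symm hkj.symm fun a => by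
    simp only [hMdef, ident]; congr 1; clear * - hij hki hkj; grind [update_apply]
  have hjk' : ∀ a, a j = a k → f a = M a (a k) := key j i hkj.symm hki.symm fun a => by
    simp only [hMdef, ident]; congr 1; clear * - hij hki hkj; grind [update_apply]
  have hmerge : ∀ a, ident f i l (update a j (a k)) = M a (a k) := fun a => by
    rw [ident, hjk' _ (by simp [update_of_ne, hij.symm, hki, hkj]), hMi, hMj,
      update_of_ne hki, update_of_ne hkj]
  -- Whichever of j, k is inessential in `ident f i l`, giving it the value a l makes it equal to
  -- the i-th entry and moves the argument x of M from a j to a l.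
  have hconst : ∀ a, M a (a j) = M a (a l) := by
    rcases not_isEssential_of_merge hkj.symm hmerge (hess ▸ hmax i l (Ne.symm hli)) with h | h
    · intro a
      have h2 := hmerge (update a k (a j))
      rw [not_isEssential_iff.1 h, hMk, update_self, ← not_isEssential_iff.1 h _ (a l), ident,
        hij' _ (by simp [update_of_ne, hij.symm, hlj, hlk])] at h2
      simpa [hMi, hMj, hMk, update_of_ne, hij.symm, hlj, hlk] using h2.symm
    · intro a
      have h2 := hmerge (update a k (a j))
      rw [← not_isEssential_iff.1 h _ (a l), ident,
        hik' _ (by simp [update_of_ne, hki, hlj, hlk])] at h2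
      simpa [hMi, hMj, hMk, update_of_ne, hki, hlj, hlk, hkj] using h2.symm
  refine not_isEssential_iff.2 (fun a c => ?_) hj
  simp only [hPM]
  rw [hconst, hconst, hMj, update_of_ne hlj]

end Maximal

/-! ### Propagation from one maximal minor to all pairs -/

section Inessential

variable {n : ℕ} {f G : (Fin n → A) → B} {i j : Fin n}

/-- If `f` agrees with `G` whenever the `i`-th and `j`-th entries agree, `i` and `j` are
inessential in `G` and `G` has maximal essential arity, then identifying the variables `i` and `k`
yields `G` or `G` with `k` replaced by `j`. -/
theorem ident_dichotomy (hij : i ≠ j) (hG : ∀ a, a i = a j → f a = G a)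
    (hGc : ∀ a b, (∀ t, t ≠ i → t ≠ j → a t = b t) → G a = G b)
    (hmax : ∀ p q, p ≠ q → ess (ident f p q) ≤ ess G) {k : Fin n} (hki : k ≠ i) (hkj : k ≠ j) :
    (∀ a, a i = a k → f a = G a) ∨ (∀ a, a i = a k → f a = G (update a k (a j))) := by
  have hmerge : ∀ a, ident f i k (update a j (a k)) = G a := fun a => by
    rw [ident, hG _ (by simp [update_of_ne, hij.symm, hkj])]
    exact hGc _ _ fun t hi hj => by simp [hi, hj]
  refine (not_isEssential_of_merge hkj.symm hmerge (hmax i k hki.symm)).imp ?_ ?_ <;>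
    intro h a ha
  · rw [← hmerge, not_isEssential_iff.1 h, ident_apply_of_eq ha]
  · rw [← hmerge, ← ident_apply_of_eq (f := f) ha, ← not_isEssential_iff.1 h a (a j)]
    congr 1
    clear * - hkj
    grind [update_apply]

/-- A single k for which the first option of `ident_dichotomy` fails forces the second option at
every variable, from i and from j alike. In it f reads the entry left over after cancelling the
equal pair, which makes the identified variable inessential. -/
theorem all_not_isEssential_ident (hn : 4 ≤ n) (hij : i ≠ j) (hG : ∀ a, a i = a j → f a = G a)
    (hGc : ∀ a b, (∀ t, t ≠ i → t ≠ j → a t = b t) → G a = G b)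
    (hmax : ∀ p q, p ≠ q → ess (ident f p q) ≤ ess G)
    (hess : ∀ p q, p ≠ q → ess (ident f p q) + 2 ≤ n)
    (hk : ∃ k, k ≠ i ∧ k ≠ j ∧ ¬ ∀ a, a i = a k → f a = G a) :
    ∀ p q, p ≠ q → ¬ IsEssential (ident f p q) q := by
  have hdi := fun k hki hkj => ident_dichotomy (k := k) hij hG hGc hmax hki hkj
  have hdj := fun k hki hkj => ident_dichotomy (k := k) hij.symm (fun a ha => hG a ha.symm)
    (fun a b h => hGc a b fun t hi hj => h t hj hi) hmax hkj hki
  obtain ⟨k, hki, hkj, hk⟩ := hk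
  have hkZ := (hdi k hki hkj).resolve_left hk
  -- On a tuple whose entries i, k, l agree, the options at l and at k give two values; as the j-th
  -- entry is free, G would not depend on k, and the first option would hold at k after all.
  have hnR : ∀ l, l ≠ i → l ≠ j → ¬ ∀ a, a i = a l → f a = G a := by
    intro l hli hlj hl
    rcases eq_or_ne k l with rfl | hkl
    · exact hk hl
    have h1 : ∀ a y, G (update a k y) = G (update a k (a l)) := by
      intro a y
      have h2 := hkZ (update (update (update a i (a l)) k (a l)) j y) (by
        clear * - hij hki hkj; grind [update_apply])
      rw [hl _ (by clear * - hij hki hkj hli hlj hkl; grind [update_apply])] at h2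
      refine Eq.trans (hGc _ _ fun t hi hj => ?_)
        (h2.symm.trans (hGc _ _ fun t hi hj => ?_)) <;>
      · clear * - hi hj hij hki hkj
        grind [update_apply]
    refine hk fun a ha => ?_
    rw [hkZ a ha, h1, ← h1 a (a k), update_eq_self]
  have hZi : ∀ l, l ≠ i → l ≠ j → ∀ a, a i = a l → f a = G (update a l (a j)) :=
    fun l hli hlj => (hdi l hli hlj).resolve_left (hnR l hli hlj)
  have hGe : ∀ l, l ≠ i → l ≠ j → ∃ a c, G (update a l c) ≠ G a := by
    intro l hli hlj
    by_contra! h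
    refine hnR l hli hlj fun a ha => ?_
    rw [hZi l hli hlj a ha, h]
  have hZj : ∀ l, l ≠ i → l ≠ j → ∀ a, a j = a l → f a = G (update a l (a i)) := by
    intro p hpi hpj
    refine (hdj p hpi hpj).resolve_left fun hR => ?_
    -- Take a tuple with entries i, l equal and entries j, p equal: the two options together would
    -- make G independent of l, against `hGe`.
    obtain ⟨l, hl⟩ := exists_notMem_of_card_lt {i, j, p} (Finset.card_le_three.trans_lt hn)
    simp only [Finset.mem_insert, Finset.mem_singleton, not_or] at hl
    obtain ⟨hli, hlj, hlp⟩ := hl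
    have h1 : ∀ a x, G (update a l x) = G (update a l (a p)) := by
      intro a x
      have h2 := hZi l hli hlj (update (update (update a i x) l x) j (a p)) (by
        clear * - hij hli hlj; grind [update_apply])
      rw [hR _ (by clear * - hij hpi hpj hli hlj hlp; grind [update_apply])] at h2
      refine Eq.trans (hGc _ _ fun t hi hj => ?_)
        (h2.trans (hGc _ _ fun t hi hj => ?_)) <;>
      · clear * - hi hj hij hli hlj
        grind [update_apply]
    obtain ⟨a, c, hac⟩ := hGe l hli hlj
    refine hac ?_
    rw [h1, ← h1 a (a l), update_eq_self]
  have hi : ∀ q, q ≠ i → ¬ IsEssential (ident f i q) q ∧ ¬ IsEssential (ident f q i) i := by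
    intro q hqi
    simp only [not_isEssential_iff]
    rcases eq_or_ne q j with rfl | hqj
    · constructor <;> intro a c <;> rw [ident, ident, hG _ (by simp [hij, hij.symm]),
        hG _ (by simp [hij, hij.symm])] <;> refine hGc _ _ fun t hi hj => ?_ <;> simp [hi, hj]
    · constructor <;> intro a c <;> rw [ident, ident, hZi q hqi hqj _ (by simp [hqi, hqi.symm]),
        hZi q hqi hqj _ (by simp [hqi, hqi.symm])] <;> refine hGc _ _ fun t hi hj => ?_ <;>
      · clear * - hi hj hij hqi hqj
        grind [update_apply]
  have hj : ∀ q, q ≠ j → ¬ IsEssential (ident f j q) q ∧ ¬ IsEssential (ident f q j) j := by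
    intro q hqj
    simp only [not_isEssential_iff]
    rcases eq_or_ne q i with rfl | hqi
    · constructor <;> intro a c <;> rw [ident, ident, hG _ (by simp [hij, hij.symm]),
        hG _ (by simp [hij, hij.symm])] <;> refine hGc _ _ fun t hi hj => ?_ <;> simp [hi, hj]
    · constructor <;> intro a c <;> rw [ident, ident, hZj q hqi hqj _ (by simp [hqj, hqj.symm]),
        hZj q hqi hqj _ (by simp [hqj, hqj.symm])] <;> refine hGc _ _ fun t hi hj => ?_ <;>
      · clear * - hi hj hij hqi hqj
        grind [update_apply]
  intro p q hpq
  rcases eq_or_ne p i with rfl | hpi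
  · exact (hi q hpq.symm).1
  rcases eq_or_ne p j with rfl | hpj
  · exact (hj q hpq.symm).1
  rcases eq_or_ne q i with rfl | hqi
  · exact (hi p hpq).2
  rcases eq_or_ne q j with rfl | hqj
  · exact (hj p hpq).2
  -- Two variables are missing from `ident f p q`, so one of them is some l ≠ p. If l ≠ q, varying l
  -- while i or j is paired with a suitable entry shows that G misses q or l, against `hGe`.
  obtain ⟨l, hlp, hl⟩ := exists_not_isEssential (f := ident f p q) {p} (hess p q hpq)
  have hlp : l ≠ p := by simpa using hlp
  have hl' := not_isEssential_iff.1 hl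
  rcases eq_or_ne l q with rfl | hlq
  · exact hl
  exfalso
  rcases eq_or_ne l i with rfl | hli
  · have h1 : ∀ a c, G (update a q (a p)) = G (update a q c) := by
      intro a c
      have h2 := hl' (update (update (update a q (a p)) j c) l (a p)) c
      rw [ident, ident, hG _ (by clear * - hij hpi hpj hqi hqj hpq; grind [update_apply]),
        hZi q hqi hqj _ (by clear * - hij hpi hpj hqi hqj hpq; grind [update_apply])] at h2
      refine Eq.trans (hGc _ _ fun t hi hj => ?_)
        (h2.trans (hGc _ _ fun t hi hj => ?_)) <;>
      · clear * - hi hj hij hpi hpj hqi hqj hpq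
        grind [update_apply]
    obtain ⟨a, c, hac⟩ := hGe q hqi hqj
    exact hac (by rw [← h1, h1 a (a q), update_eq_self])
  rcases eq_or_ne l j with rfl | hlj
  · have h1 : ∀ a c, G (update a q (a p)) = G (update a q c) := by
      intro a c
      have h2 := hl' (update (update (update a q (a p)) i c) l (a p)) c
      rw [ident, ident, hG _ (by clear * - hij hpi hpj hqi hqj hpq; grind [update_apply]),
        hZj q hqi hqj _ (by clear * - hij hpi hpj hqi hqj hpq; grind [update_apply])] at h2
      refine Eq.trans (hGc _ _ fun t hi hj => ?_)
        (h2.trans (hGc _ _ fun t hi hj => ?_)) <;>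
      · clear * - hi hj hij hpi hpj hqi hqj hpq
        grind [update_apply]
    obtain ⟨a, c, hac⟩ := hGe q hqi hqj
    exact hac (by rw [← h1, h1 a (a q), update_eq_self])
  obtain ⟨a, c, hac⟩ := hGe l hli hlj
  have h2 := hl' (update (update (update a q (a p)) j (a p)) i (a q)) c
  rw [ident, ident, hZj q hqi hqj _ (by
      clear * - hij hpi hpj hqi hqj hpq hlp hlq hli hlj; grind [update_apply]),
    hZj q hqi hqj _ (by
      clear * - hij hpi hpj hqi hqj hpq hlp hlq hli hlj; grind [update_apply])] at h2
  refine hac (Eq.trans (hGc _ _ fun t hi hj => ?_) (h2.trans (hGc _ _ fun t hi hj => ?_))) <;>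
  · clear * - hi hj hij hpi hpj hqi hqj hpq hlp hlq hli hlj
    grind [update_apply]

theorem isSupport_of_forall (hij : i ≠ j) (hG : ∀ a, a i = a j → f a = G a)
    (hGc : ∀ a b, (∀ t, t ≠ i → t ≠ j → a t = b t) → G a = G b)
    (hess : ∀ p q, p ≠ q → ess (ident f p q) + 2 ≤ n)
    (hRi : ∀ k, k ≠ i → k ≠ j → ∀ a, a i = a k → f a = G a)
    (hRj : ∀ k, k ≠ i → k ≠ j → ∀ a, a j = a k → f a = G a) :
    IsSupport G f := by
  rintro a ⟨p, q, hpq, ha⟩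
  symm
  rcases eq_or_ne p i with rfl | hpi
  · rcases eq_or_ne q j with rfl | hqj
    · exact hG a ha
    · exact hRi q hpq.symm hqj a ha
  rcases eq_or_ne p j with rfl | hpj
  · rcases eq_or_ne q i with rfl | hqi
    · exact hG a ha.symm
    · exact hRj q hqi hpq.symm a ha
  rcases eq_or_ne q i with rfl | hqi
  · exact hRi p hpi hpj a ha.symm
  rcases eq_or_ne q j with rfl | hqj
  · exact hRj p hpi hpj a ha.symm
  -- The missing variable l is free to move: it is used to create an equality with entry i or j,
  -- where `f` is known to be G.
  obtain ⟨l, hlp, hl⟩ := exists_not_isEssential (f := ident f p q) {p} (hess p q hpq)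
  have hlp : l ≠ p := by simpa using hlp
  have hl' := not_isEssential_iff.1 hl
  have hGi : ∀ c, G (update a i c) = G a := fun c => hGc _ _ fun t hi hj => by simp [hi]
  have hGj : ∀ c, G (update a j c) = G a := fun c => hGc _ _ fun t hi hj => by simp [hj]
  rcases eq_or_ne l i with rfl | hli
  · rw [← ident_apply_of_eq (f := f) ha, ← hl' _ (a j), ident_apply_of_eq (by simp [*]),
      hG _ (by simp [hij.symm]), hGi]
  rcases eq_or_ne l j with rfl | hlj
  · rw [← ident_apply_of_eq (f := f) ha, ← hl' _ (a i), ident_apply_of_eq (by simp [*]),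
      hG _ (by simp [hij]), hGj]
  rcases eq_or_ne l q with rfl | hlq
  · have h1 : ∀ b, ident f p l b = G (update (update b l (b i)) p (b i)) := by
      intro b
      rw [← hl' b (b i), ident, hRi l hli hlj _ (by simp [hpi.symm, hlp, hli.symm]), update_self]
    have h2 := h1 (update a j (a l))
    rw [ident_apply_of_eq (by simp [*]), hRj l hli hlj _ (by simp [hlj]), hGj] at h2
    rw [h2, ← ident_apply_of_eq (f := f) ha, h1]
    refine hGc _ _ fun t hi hj => ?_
    clear * - hi hj hij
    grind [update_apply]
  · have h1 : ∀ b, b p = b q → f b = f (update b l (a i)) := by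
      intro b hb
      rw [← ident_apply_of_eq (f := f) hb, ← hl' b (a i), ident_apply_of_eq]
      simp [hlp.symm, hlq.symm, hb]
    rw [h1 a ha, hRi l hli hlj _ (by simp [hli.symm])]
    have h2 := h1 (update a i (a j)) (by simp [*])
    rw [hG _ (by simp [hij.symm]), hG _ (by simp [hij.symm, hli.symm, hlj.symm]), hGi] at h2
    rw [h2]
    refine hGc _ _ fun t hi hj => ?_
    clear * - hi hj hij
    grind [update_apply]

end Inessential

/-- If all identification minors of `f` miss at least two variables, then `f` has a support that
does not depend on all variables, or all identified variables are inessential. -/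
theorem qa_lt_or_all_not_isEssential {n : ℕ} (hn : 4 ≤ n) {f : (Fin n → A) → B}
    (h : ∀ i j, i ≠ j → ess (ident f i j) + 2 ≤ n) :
    qa f < n ∨ ∀ i j, i ≠ j → ¬ IsEssential (ident f i j) j := by
  -- Extremal choice: a pair (i, j) whose minor has the largest essential arity.
  have hne : ((Finset.univ : Finset (Fin n × Fin n)).filter fun e => e.1 ≠ e.2).Nonempty :=
    ⟨(⟨0, by omega⟩, ⟨1, by omega⟩), by simp⟩
  obtain ⟨e, he, hmax⟩ := Finset.exists_max_image _ (fun e => ess (ident f e.1 e.2)) hne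
  simp only [Finset.mem_filter, Finset.mem_univ, true_and, Prod.forall] at he hmax
  obtain ⟨i, j, hij, hm, hj⟩ := exists_ident_not_isEssential hn (h _ _ he) hmax he rfl
  rw [← hm] at hmax
  have hG : ∀ a, a i = a j → f a = ident f i j a := fun a ha => (ident_apply_of_eq ha).symm
  have hi : ¬ IsEssential (ident f i j) i := not_isEssential_ident_left hij
  have hGc : ∀ a b, (∀ t, t ≠ i → t ≠ j → a t = b t) → ident f i j a = ident f i j b := by
    intro a b hab
    refine apply_eq_of_eqOn_essential _ {i, j} a b (by simp [hi, hj]) fun t ht => ?_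
    simp only [Finset.mem_insert, Finset.mem_singleton, not_or] at ht
    exact hab t ht.1 ht.2
  by_cases hRi : ∀ k, k ≠ i → k ≠ j → ∀ a, a i = a k → f a = ident f i j a
  swap
  · push Not at hRi
    exact Or.inr (all_not_isEssential_ident hn hij hG hGc hmax h
      (by simpa only [not_forall, exists_prop] using hRi))
  by_cases hRj : ∀ k, k ≠ i → k ≠ j → ∀ a, a j = a k → f a = ident f i j a
  swap
  · push Not at hRj
    obtain ⟨k, hki, hkj, hk⟩ := hRj
    exact Or.inr (all_not_isEssential_ident hn hij.symm (fun a ha => hG a ha.symm)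
      (fun a b h => hGc a b fun t hi hj => h t hj hi) hmax h
      ⟨k, hkj, hki, by simpa only [not_forall, exists_prop] using hk⟩)
  have hS := isSupport_of_forall hij hG hGc h hRi hRj
  have h1 := (isLeast_qa f).2 ⟨_, hS, rfl⟩
  have h2 := h i j hij
  left
  omega

/-! ### Functions determined by `oddsupp` -/

section Oddsupp

variable {n : ℕ} {f : (Fin n → A) → B}

theorem mem_oddsupp_iff [DecidableEq A] {a : Fin n → A} {x : A} :
    x ∈ oddsupp a ↔ Odd (Finset.univ.filter fun j => a j = x).card := by
  have hc : ∀ y : A, {j | a j = y}.ncard = (Finset.univ.filter fun j => a j = y).card := by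
    intro y
    rw [← Set.ncard_coe_finset]
    simp
  constructor
  · rintro ⟨i, rfl, h⟩
    rwa [← hc]
  · intro h
    obtain ⟨i, hi⟩ := Finset.card_pos.1 h.pos
    obtain rfl : a i = x := by simpa using hi
    exact ⟨i, rfl, by rwa [hc]⟩

theorem oddsupp_update_update {a : Fin n → A} {i j : Fin n} (hij : i ≠ j) (ha : a i = a j)
    (c : A) : oddsupp (update (update a j c) i c) = oddsupp a := by
  classical
  have key : ∀ b : Fin n → A, b i = b j → ∀ x, Odd (Finset.univ.filter fun t => b t = x).card ↔
      Odd (((Finset.univ.erase i).erase j).filter fun t => b t = x).card := by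
    intro b hb x
    rw [Finset.card_filter, Finset.card_filter, ← Finset.add_sum_erase _ _ (Finset.mem_univ i),
      ← Finset.add_sum_erase _ _ (Finset.mem_erase.2 ⟨hij.symm, Finset.mem_univ j⟩), hb,
      ← add_assoc, ← two_mul, Nat.odd_add']
    split_ifs <;> simp
  ext x
  rw [mem_oddsupp_iff, mem_oddsupp_iff, key _ (by simp [hij.symm]), key a ha]
  have : ∀ t ∈ (Finset.univ.erase i).erase j, update (update a j c) i c t = a t := by
    intro t ht
    simp only [Finset.mem_erase] at ht
    simp [ht.1, ht.2.1]
  rw [Finset.filter_congr fun t ht => by rw [this t ht]]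

theorem oddsupp_comp_perm (a : Fin n → A) (σ : Equiv.Perm (Fin n)) :
    oddsupp (a ∘ σ) = oddsupp a := by
  classical
  ext x
  rw [mem_oddsupp_iff, mem_oddsupp_iff]
  have : (Finset.univ.filter fun j => a j = x) =
      (Finset.univ.filter fun j => (a ∘ σ) j = x).map σ.toEmbedding := by
    ext t
    simp
  rw [this, Finset.card_map]

theorem apply_update_update (hZ : ∀ i j, i ≠ j → ¬ IsEssential (ident f i j) j)
    {a : Fin n → A} {i j : Fin n} (hij : i ≠ j) (ha : a i = a j) (c : A) :
    f (update (update a j c) i c) = f a := by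
  rw [← ident_apply_of_eq (f := f) ha, ← not_isEssential_iff.1 (hZ i j hij) a c, ident, update_self]

theorem comp_perm_mem_eqTuples {a : Fin n → A} (ha : a ∈ eqTuples A n)
    (σ : Equiv.Perm (Fin n)) : a ∘ σ ∈ eqTuples A n := by
  obtain ⟨i, j, hij, h⟩ := ha
  exact ⟨σ.symm i, σ.symm j, by simpa, by simpa⟩

/-- The equal pair i, j serves as a buffer. Changing equal pairs together turns (x, x, z) into (z,
z, z) and then (z, x, x); for k, l outside the pair, (x, x, y, w) passes through (y, y, y, w), (w,
y, w, w), (y, y, w, y) to (x, x, w, y). -/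
theorem apply_comp_swap (hZ : ∀ i j, i ≠ j → ¬ IsEssential (ident f i j) j)
    {a : Fin n → A} (ha : a ∈ eqTuples A n) (k l : Fin n) : f (a ∘ Equiv.swap k l) = f a := by
  obtain ⟨i, j, hij, ha⟩ := ha
  have h1 : ∀ i j k : Fin n, i ≠ j → i ≠ k → j ≠ k → a i = a j →
      f (a ∘ Equiv.swap i k) = f a := by
    intro i j k hij hik hjk h
    symm
    rw [← apply_update_update hZ hij h (a k), ← apply_update_update hZ hjk (c := a i)
      (by simp [hik.symm, hjk.symm, hij.symm])]
    congr 1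
    clear * - hij hik hjk h
    grind [update_apply]
  rcases eq_or_ne k l with rfl | hkl
  · simp
  rcases eq_or_ne i k with rfl | hik
  · rcases eq_or_ne j l with rfl | hjl
    · congr 1
      clear * - ha
      grind
    · exact h1 i j l hij hkl hjl ha
  rcases eq_or_ne i l with rfl | hil
  · rw [Equiv.swap_comm]
    rcases eq_or_ne j k with rfl | hjk
    · congr 1
      clear * - ha
      grind
    · exact h1 i j k hij hik hjk ha
  rcases eq_or_ne j k with rfl | hjk
  · exact h1 j i l hij.symm hkl hil ha.symm
  rcases eq_or_ne j l with rfl | hjl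
  · rw [Equiv.swap_comm]
    exact h1 j i k hij.symm hjk hik ha.symm
  symm
  rw [← apply_update_update hZ hij ha (a k),
    ← apply_update_update hZ hik (c := a l) (by simp [hik.symm, hjk.symm]),
    ← apply_update_update hZ hil (c := a k)
      (by simp [hil.symm, hjl.symm, hkl.symm]),
    ← apply_update_update hZ hij (c := a i)
      (by simp [hij.symm, hjk, hjl])]
  congr 1
  funext t
  clear * - hij hik hil hjk hjl hkl ha
  simp only [update_apply, comp_apply, Equiv.swap_apply_def]
  grind

theorem apply_comp_perm (hZ : ∀ i j, i ≠ j → ¬ IsEssential (ident f i j) j)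
    {a : Fin n → A} (ha : a ∈ eqTuples A n) (σ : Equiv.Perm (Fin n)) : f (a ∘ σ) = f a := by
  induction σ using Equiv.Perm.swap_induction_on generalizing a with
  | one => simp
  | swap_mul σ x y _ ih =>
    rw [Equiv.Perm.coe_mul, ← comp_assoc, ih (comp_perm_mem_eqTuples ha _), apply_comp_swap hZ ha]

/-- Moving a repeated pair of entries other than c to c lowers the number of entries different from
c, so the process stops. -/
theorem exists_reduced (hZ : ∀ i j, i ≠ j → ¬ IsEssential (ident f i j) j) (c : A) :
    ∀ a ∈ eqTuples A n, ∃ b ∈ eqTuples A n, f b = f a ∧ oddsupp b = oddsupp a ∧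
      ∀ p q, p ≠ q → b p = b q → b p = c := by
  classical
  intro a ha
  induction h : (Finset.univ.filter fun t => a t ≠ c).card using Nat.strong_induction_on
    generalizing a with
  | _ r ih =>
    by_cases hr : ∀ p q, p ≠ q → a p = a q → a p = c
    · exact ⟨a, ha, rfl, rfl, hr⟩
    push Not at hr
    obtain ⟨p, q, hpq, hapq, hap⟩ := hr
    have hlt : (Finset.univ.filter fun t => update (update a q c) p c t ≠ c).card < r := by
      rw [← h]
      refine Finset.card_lt_card ⟨fun t ht => ?_, fun hsub => ?_⟩
      · simp only [Finset.mem_filter, Finset.mem_univ, true_and] at ht ⊢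
        clear * - ht
        grind [update_apply]
      · have := hsub (Finset.mem_filter.2 ⟨Finset.mem_univ p, hap⟩)
        simp at this
    obtain ⟨b, hb, h1, h2, h3⟩ := ih _ hlt (update (update a q c) p c)
      ⟨p, q, hpq, by simp [hpq.symm]⟩ rfl
    exact ⟨b, hb, h1.trans (apply_update_update hZ hpq hapq c),
      h2.trans (oddsupp_update_update hpq hapq c), h3⟩

/-- Elements other than c occur at most once, so `oddsupp` gives their multiplicities, and the total
n gives that of c. -/
theorem exists_perm_of_oddsupp_eq [Finite A] {a b : Fin n → A} {c : A}
    (ha : ∀ p q, p ≠ q → a p = a q → a p = c) (hb : ∀ p q, p ≠ q → b p = b q → b p = c)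
    (h : oddsupp a = oddsupp b) : ∃ σ : Equiv.Perm (Fin n), a ∘ σ = b := by
  classical
  have := Fintype.ofFinite A
  have hle : ∀ a : Fin n → A, (∀ p q, p ≠ q → a p = a q → a p = c) → ∀ x, x ≠ c →
      (Finset.univ.filter fun t => a t = x).card ≤ 1 := by
    intro a ha x hx
    refine Finset.card_le_one.2 fun p hp q hq => ?_
    simp only [Finset.mem_filter, Finset.mem_univ, true_and] at hp hq
    by_contra hpq
    exact hx (hp.symm.trans (ha p q hpq (hp.trans hq.symm)))
  have hne : ∀ x, x ≠ c → (Finset.univ.filter fun t => a t = x).card =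
      (Finset.univ.filter fun t => b t = x).card := by
    intro x hx
    have h1 := hle a ha x hx
    have h2 := hle b hb x hx
    have h3 : x ∈ oddsupp a ↔ x ∈ oddsupp b := by rw [h]
    rw [mem_oddsupp_iff, mem_oddsupp_iff, Nat.odd_iff, Nat.odd_iff] at h3
    omega
  have hsum : ∀ a : Fin n → A, n = (Finset.univ.filter fun t => a t = c).card +
      ∑ x ∈ Finset.univ.erase c, (Finset.univ.filter fun t => a t = x).card := by
    intro a
    rw [Finset.add_sum_erase _ (fun x => (Finset.univ.filter fun t => a t = x).card)
      (Finset.mem_univ c)]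
    exact (Finset.card_fin n).symm.trans (Finset.card_eq_sum_card_fiberwise
      fun _ _ => Finset.mem_coe.2 (Finset.mem_univ _))
  have heq : ∀ x, Fintype.card {t // b t = x} = Fintype.card {t // a t = x} := by
    intro x
    rw [Fintype.card_subtype, Fintype.card_subtype]
    rcases eq_or_ne x c with rfl | hx
    · have h1 := hsum a
      rw [Finset.sum_congr rfl fun y hy => hne y (Finset.ne_of_mem_erase hy)] at h1
      have h2 := hsum b
      omega
    · exact (hne x hx).symm
  refine ⟨(Equiv.sigmaFiberEquiv b).symm.trans ((Equiv.sigmaCongrRight fun x =>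
    Fintype.equivOfCardEq (heq x)).trans (Equiv.sigmaFiberEquiv a)), funext fun t => ?_⟩
  exact (Fintype.equivOfCardEq (heq (b t)) ⟨t, rfl⟩).2

theorem apply_eq_of_oddsupp_eq [Finite A]
    (hZ : ∀ i j, i ≠ j → ¬ IsEssential (ident f i j) j) {a b : Fin n → A}
    (ha : a ∈ eqTuples A n) (hb : b ∈ eqTuples A n) (h : oddsupp a = oddsupp b) : f a = f b := by
  have ⟨i, _⟩ := ha
  obtain ⟨a', ha', h1, h2, h3⟩ := exists_reduced hZ (a i) a ha
  obtain ⟨b', hb', h4, h5, h6⟩ := exists_reduced hZ (a i) b hb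
  obtain ⟨σ, hσ⟩ := exists_perm_of_oddsupp_eq h3 h6 (h2.trans (h.trans h5.symm))
  rw [← h1, ← h4, ← hσ, apply_comp_perm hZ ha']

theorem isDeterminedByOddsupp [Finite A] (hn : 2 ≤ n) (hf : DependsOnAll f)
    (hZ : ∀ i j, i ≠ j → ¬ IsEssential (ident f i j) j) (hqa : qa f ≠ 0) :
    IsDeterminedByOddsupp f := by
  classical
  obtain ⟨-, c, -⟩ := hf ⟨0, by omega⟩
  -- The diagonal value is a default for parity sets that are not the `oddsupp` of any tuple with a
  -- repetition.
  let φ : paritySubsets A n → B := fun S =>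
    if h : ∃ a ∈ eqTuples A n, oddsupp a = S then f h.choose else f fun _ => c
  have hφ : ∀ (a : Fin n → A) (ha : a ∈ eqTuples A n), f a = φ ⟨oddsupp a, oddsupp_mem ha⟩ := by
    intro a ha
    have h : ∃ b ∈ eqTuples A n, oddsupp b = oddsupp a := ⟨a, ha, rfl⟩
    simp only [φ, dif_pos h]
    exact apply_eq_of_oddsupp_eq hZ ha h.choose_spec.1 h.choose_spec.2.symm
  refine ⟨φ, ?_, hφ⟩
  by_contra! hc
  refine hqa (qa_eq_zero hn hf fun i j hij => ess_eq_zero_iff.2 fun a b => ?_)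
  rw [ident, ident, hφ _ (update_mem_eqTuples hij a), hφ _ (update_mem_eqTuples hij b)]
  exact hc _ _

/-- Every `ident f i j` misses both i and j. Some such minor is nonconstant because qa f ≠ 0, and it
is symmetric in the other n - 2 variables, so all of them are essential. -/
theorem essLower_of_isDeterminedByOddsupp (hn : 2 ≤ n) (hf : DependsOnAll f) (hqa : qa f ≠ 0)
    (h : IsDeterminedByOddsupp f) : essLower f = n - 2 := by
  classical
  obtain ⟨φ, -, hφ⟩ := h
  have hodd : ∀ {a b : Fin n → A}, a ∈ eqTuples A n → b ∈ eqTuples A n →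
      oddsupp a = oddsupp b → f a = f b := by
    intro a b ha hb h
    rw [hφ a ha, hφ b hb]
    exact congrArg φ (Subtype.ext h)
  have hZ : ∀ i j, i ≠ j → ¬ IsEssential (ident f i j) j := by
    intro i j hij
    rw [not_isEssential_iff]
    intro a c
    refine hodd (update_mem_eqTuples hij _) (update_mem_eqTuples hij _) ?_
    have h1 := oddsupp_update_update hij (a := update a i (a j)) (by simp [hij.symm]) c
    rw [← h1]
    congr 1
    clear * - hij
    grind [update_apply]
  apply le_antisymm
  · obtain ⟨i, j, hij, he⟩ := exists_ess_ident_eq_essLower hn hf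
    have h1 := ess_add_card_le (f := ident f i j) {i, j} (by
      simp [not_isEssential_ident_left hij, hZ i j hij])
    rw [Finset.card_pair hij] at h1
    omega
  · have : ∃ i j, i ≠ j ∧ ess (ident f i j) ≠ 0 := by
      by_contra! h
      exact hqa (qa_eq_zero hn hf h)
    obtain ⟨i, j, hij, h0⟩ := this
    have hk : ∃ k, IsEssential (ident f i j) k := by
      by_contra! h
      have := ess_add_card_le (f := ident f i j) Finset.univ fun i _ => h i
      rw [Finset.card_fin] at this
      omega
    obtain ⟨k, hk⟩ := hk
    have hki : k ≠ i := fun h => not_isEssential_ident_left hij (h ▸ hk)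
    have hkj : k ≠ j := fun h => hZ i j hij (h ▸ hk)
    obtain ⟨a, c, hac⟩ := hk
    have hess : ∀ l ∈ ({i, j} : Finset (Fin n))ᶜ, IsEssential (ident f i j) l := by
      intro l hl
      simp only [Finset.mem_compl, Finset.mem_insert, Finset.mem_singleton, not_or] at hl
      obtain ⟨hli, hlj⟩ := hl
      have hswap : ∀ b, ident f i j (b ∘ Equiv.swap k l) = ident f i j b := by
        intro b
        refine hodd (update_mem_eqTuples hij _) (update_mem_eqTuples hij _) ?_
        rw [← oddsupp_comp_perm (update b i (b j)) (Equiv.swap k l)]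
        congr 1
        clear * - hij hki hkj hli hlj
        grind [update_apply]
      refine ⟨a ∘ Equiv.swap k l, c, ?_⟩
      have : update (a ∘ Equiv.swap k l) l c = update a k c ∘ Equiv.swap k l := by
        clear * -
        grind [update_apply]
      rwa [this, hswap, hswap]
    have h1 := le_ess_of_isEssential _ hess
    rw [Finset.card_compl, Finset.card_pair hij, Fintype.card_fin] at h1
    exact h1.trans (ess_ident_le_essLower hn hf hij)

end Oddsupp

/-! ### The ternary case -/

section Ternary

variable {f : (Fin 3 → A) → B}

theorem essLower_of_hasUnaryIdentifications (hf : DependsOnAll f)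
    (h : HasUnaryIdentifications f rfl) : essLower f = 1 := by
  obtain ⟨h, i₁, i₂, i₃, ⟨s, t, hst⟩, hx⟩ := h
  have key : ∀ (i j r : Fin 3) (l : Fin 2), i ≠ j →
      (∀ (x : Fin 2 → A) (a : Fin 3 → A), a i = x 0 → a j = x 0 → a r = x 1 → f a = h (x l)) →
      i ≠ r → ∃ k, ∀ a, ident f i j a = h (a k) := by
    intro i j r l hij H hir
    refine ⟨![j, r] l, fun a => ?_⟩
    rw [ident, H ![a j, a r] _ (by simp) (by simp [hij.symm]) (by simp [hir.symm])]
    fin_cases l <;> rfl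
  have h0 : ∀ (x : Fin 2 → A) (a : Fin 3 → A),
      a 1 = x 0 → a 2 = x 0 → a 0 = x 1 → f a = h (x i₁) := by
    intro x a h1 h2 h3
    rw [← (hx x).1]
    exact congrArg f (funext fun k => by fin_cases k <;> assumption)
  have h1 : ∀ (x : Fin 2 → A) (a : Fin 3 → A),
      a 0 = x 0 → a 2 = x 0 → a 1 = x 1 → f a = h (x i₂) := by
    intro x a h1 h2 h3
    rw [← (hx x).2.1]
    exact congrArg f (funext fun k => by fin_cases k <;> assumption)
  have h2 : ∀ (x : Fin 2 → A) (a : Fin 3 → A),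
      a 0 = x 0 → a 1 = x 0 → a 2 = x 1 → f a = h (x i₃) := by
    intro x a h1 h2 h3
    rw [← (hx x).2.2]
    exact congrArg f (funext fun k => by fin_cases k <;> assumption)
  have hk : ∀ i j, i ≠ j → ∃ k, ∀ a, ident f i j a = h (a k) := by
    intro i j hij
    fin_cases i <;> fin_cases j
    · exact absurd rfl hij
    · exact key 0 1 2 i₃ hij h2 (by decide)
    · exact key 0 2 1 i₂ hij h1 (by decide)
    · exact key 1 0 2 i₃ hij (fun x a h h' => h2 x a h' h) (by decide)
    · exact absurd rfl hij
    · exact key 1 2 0 i₁ hij h0 (by decide)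
    · exact key 2 0 1 i₂ hij (fun x a h h' => h1 x a h' h) (by decide)
    · exact key 2 1 0 i₁ hij (fun x a h h' => h0 x a h' h) (by decide)
    · exact absurd rfl hij
  obtain ⟨i, j, hij, he⟩ := exists_ess_ident_eq_essLower (by norm_num) hf
  obtain ⟨k, hk⟩ := hk i j hij
  rw [← he]
  apply le_antisymm
  · have := ess_add_card_le (f := ident f i j) {k}ᶜ fun l hl => by
      rw [not_isEssential_iff]
      intro a c
      rw [hk, hk, update_of_ne (by simpa [eq_comm] using hl)]
    rw [Finset.card_compl, Finset.card_singleton, Fintype.card_fin] at this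
    omega
  · refine Nat.one_le_iff_ne_zero.2 fun h0 => hst ?_
    have := ess_eq_zero_iff.1 h0 (fun _ => s) (fun _ => t)
    rwa [hk, hk] at this

/-- Each identification minor depends on at most one variable, so it reads off the diagonal of `f`
at one entry; the diagonal is the function h. -/
theorem hasUnaryIdentifications (hf : DependsOnAll f) (h : essLower f = 1) :
    HasUnaryIdentifications f rfl := by
  have key : ∀ i j r : Fin 3, i ≠ j → i ≠ r → j ≠ r → ∃ l : Fin 2, ∀ (x : Fin 2 → A)
      (a : Fin 3 → A), a i = x 0 → a j = x 0 → a r = x 1 → f a = f fun _ => x l := by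
    intro i j r hij hir hjr
    have hall : ∀ t, t = i ∨ t = j ∨ t = r := by
      clear * - hij hir hjr
      omega
    obtain ⟨k, hki, hk⟩ := exists_not_isEssential (f := ident f i j) {i} (by
      have := ess_ident_le_essLower (by norm_num) hf hij
      simp only [Finset.card_singleton]
      omega)
    have hk' := not_isEssential_iff.1 hk
    rcases hall k with rfl | rfl | rfl
    · simp at hki
    · refine ⟨1, fun x a hi hj hr => ?_⟩
      rw [← ident_apply_of_eq (f := f) (hi.trans hj.symm), ← hk' a (x 1), ident]
      refine congrArg f (funext fun t => ?_)
      rcases hall t with rfl | rfl | rfl <;> simp [*, Ne.symm]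
    · refine ⟨0, fun x a hi hj hr => ?_⟩
      rw [← ident_apply_of_eq (f := f) (hi.trans hj.symm), ← hk' a (x 0), ident]
      refine congrArg f (funext fun t => ?_)
      rcases hall t with rfl | rfl | rfl <;> simp [*, Ne.symm]
  obtain ⟨i₁, h1⟩ := key 1 2 0 (by decide) (by decide) (by decide)
  obtain ⟨i₂, h2⟩ := key 0 2 1 (by decide) (by decide) (by decide)
  obtain ⟨i₃, h3⟩ := key 0 1 2 (by decide) (by decide) (by decide)
  refine ⟨fun x => f fun _ => x, i₁, i₂, i₃, ?_, fun x => ⟨h1 x _ rfl rfl rfl, h2 x _ rfl rfl rfl,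
    h3 x _ rfl rfl rfl⟩⟩
  by_contra! hc
  obtain ⟨i, j, hij, he⟩ := exists_ess_ident_eq_essLower (by norm_num) hf
  -- If the diagonal were constant, the maximal minor would be constant too, not of arity 1.
  have : ∃ r, i ≠ r ∧ j ≠ r := by
    clear * -
    revert i j
    decide
  obtain ⟨r, hir, hjr⟩ := this
  obtain ⟨l, hl⟩ := key i j r hij hir hjr
  have h0 : ess (ident f i j) = 0 := by
    have hl' : ∀ a, ident f i j a = f fun _ => ![a j, a r] l := fun a => by
      rw [ident, hl ![a j, a r] _ (by simp) (by simp [hij.symm]) (by simp [hir.symm])]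
    exact ess_eq_zero_iff.2 fun a b => by rw [hl', hl', hc]
  omega

end Ternary

end ArityGap

/-! ### The classification -/

theorem mainTheorem1 {A B : Type*} [Finite A] (n : ℕ) (hn : 2 ≤ n) (f : (Fin n → A) → B)
    (hf : ArityGap.DependsOnAll f) :
    (∀ m : ℕ, m + 3 ≤ n → (ArityGap.gap f = n - m ↔ ArityGap.qa f = m)) ∧
    (n ≠ 3 → (ArityGap.gap f = 2 ↔
      ArityGap.qa f = n - 2 ∨ (ArityGap.qa f = n ∧ ArityGap.IsDeterminedByOddsupp f))) ∧
    (∀ h3 : n = 3, (ArityGap.gap f = 2 ↔ ArityGap.HasUnaryIdentifications f h3)) ∧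
    (¬ (ArityGap.qa f + 3 ≤ n) →
      ¬ (n ≠ 3 ∧ (ArityGap.qa f = n - 2 ∨
        (ArityGap.qa f = n ∧ ArityGap.IsDeterminedByOddsupp f))) →
      ¬ (∃ h3 : n = 3, ArityGap.HasUnaryIdentifications f h3) →
      ArityGap.gap f = 1) := by
  have hgap := ArityGap.gap_eq hf
  have hle : ArityGap.qa f ≤ n := ArityGap.qa_le
  have hlow := ArityGap.essLower_le_pred hn hf
  have hlt := ArityGap.essLower_eq_qa hn hf
  have hzero := ArityGap.qa_eq_zero_of_essLower hn hf
  have hdet := ArityGap.essLower_of_isDeterminedByOddsupp hn hf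
  have hlarge : 4 ≤ n → ArityGap.qa f = n → ArityGap.essLower f + 2 ≤ n →
      ArityGap.IsDeterminedByOddsupp f := by
    intro h4 hq hl
    refine ArityGap.isDeterminedByOddsupp hn hf ((ArityGap.qa_lt_or_all_not_isEssential h4
      fun i j hij => ?_).resolve_left (by omega)) (by omega)
    have := ArityGap.ess_ident_le_essLower hn hf hij
    omega
  have hternary : ∀ h3 : n = 3,
      (ArityGap.HasUnaryIdentifications f h3 ↔ ArityGap.essLower f = 1) := by
    rintro rfl
    exact ⟨ArityGap.essLower_of_hasUnaryIdentifications hf, ArityGap.hasUnaryIdentifications hf⟩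
  refine ⟨fun m hm => ⟨fun h => ?_, fun h => ?_⟩, fun h3 => ⟨fun h => ?_, fun h => ?_⟩,
    fun h3 => ?_, fun h1 h2 h3 => ?_⟩
  -- If qa f < n the gap is n - qa f, so qa f = n here. For n = 3 this would mean `essLower f` = 0,
  -- which `hzero` excludes; for n ≥ 4 `hlarge` and `hdet` force gap 2, but n - m ≥ 3.
  · by_contra hq
    have hqn : ArityGap.qa f = n := by omega
    have := hdet (by omega) (hlarge (by omega) hqn (by omega))
    omega
  · omega
  · by_cases hq : ArityGap.qa f < n
    · omega
    · exact Or.inr ⟨by omega, hlarge (by omega) (by omega) (by omega)⟩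
  · rcases h with h | ⟨hq, h⟩
    · omega
    · have := hdet (by omega) h
      omega
  · rw [hternary h3]
    omega
  · by_cases h3' : n = 3
    · have h4 : ArityGap.essLower f ≠ 1 := fun h => h3 ⟨h3', (hternary h3').2 h⟩
      omega
    · by_cases hq : ArityGap.qa f = n
      · have h4 : ¬ (4 ≤ n ∧ ArityGap.essLower f + 2 ≤ n) :=
          fun h => h2 ⟨h3', Or.inr ⟨hq, hlarge h.1 hq h.2⟩⟩
        omega
      · have h4 : ArityGap.qa f ≠ n - 2 := fun h => h2 ⟨h3', Or.inl h⟩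
        omega
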